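/- Conventions. Let $L$ be a field. An $L$-bimodule $P$ is an abelian group with commuting left and right $L$-actions (equivalently, a module over $L\otimes_{\mathbb Z}L^{\rm op}$); the two actions need not coincide. For $a\in L$ let $\phi_P(a)\colon x\mapsto xa$, a left $L$-linear endomorphism of $P$. The center of $P$ is the subfield $\mathcal Z(P)=\{z\in L : zx=xz\text{ for all }x\in P\}$. "Contains" means: there is an injective bimodule homomorphism into. $P$ is weakly Galois of rank $d\ge 1$ if $P\cong L^d$ as a left $L$-vector space, $P\cong L^d$ as a right $L$-vector space, and the $L$-bimodule $P^N$ contains $P\otimes_L P$ for some $N$. $P$ is split if for every $a\in L$ all eigenvalues of $\phi_P(a)$ (in an algebraic closure of $L$) lie in $L$. The socle filtration of $P$ is given by $\mathbf F_0P=0$ and $\mathbf F_{i+1}P/\mathbf F_iP=$ the sum of all simple sub-bimodules of $P/\mathbf F_iP$, and ${\rm gr}(P)=\bigoplus_i\mathbf F_{i+1}P/\mathbf F_iP$. A split weakly Galois $L$-bimodule $P$ of rank $d$ is purely inseparable if ${\rm gr}(P)\cong L^d$ as $L$-bimodules, where $L$ is the bimodule with left and right multiplication. Theorem. Let $P$ be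 a purely inseparable weakly Galois $L$-bimodule of rank $d$. Then $L$ is a finite purely inseparable field extension of $\mathcal Z(P)$ (in characteristic $0$ this means $L=\mathcal Z(P)$). Moreover, $P$ contains the $L$-bimodule $L\otimes_{\mathcal Z(P)}L$. -/

import Mathlib

set_option maxSynthPendingDepth 3

open scoped TensorProduct DirectSum
open MulOpposite

noncomputable section

namespace GaloisBimodule

universe u v

/-- The enveloping ring `A ⊗_ℤ Aᵐᵒᵖ` of a ring `A`. An `A`-bimodule is an abelian group `P` with
`[Module (Env A) P]`; the element `a ⊗ₜ op b` acts as `x ↦ a x b`. Sub-bimodules, bimodule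
homomorphisms, quotient bimodules and simple bimodules are the corresponding notions for
`Env A`-modules. -/
abbrev Env (A : Type u) [Ring A] : Type u := A ⊗[ℤ] Aᵐᵒᵖ

/-! ### The two one-sided structures of a bimodule -/

section OneSided

variable (A : Type u) [Ring A] (P : Type v) [AddCommGroup P] [Module (Env A) P]

/-- The left `A`-module underlying a bimodule: `a • x = (a ⊗ₜ 1) • x`. -/
abbrev leftModule : Module A P :=
  Module.compHom P
    (Algebra.TensorProduct.includeLeft : A →ₐ[ℤ] A ⊗[ℤ] Aᵐᵒᵖ).toRingHom

/-- The right `A`-module underlying a bimodule: `op a • x = (1 ⊗ₜ op a) • x`. -/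
abbrev rightModule : Module Aᵐᵒᵖ P :=
  Module.compHom P
    (Algebra.TensorProduct.includeRight : Aᵐᵒᵖ →ₐ[ℤ] A ⊗[ℤ] Aᵐᵒᵖ).toRingHom

/-- `P` is isomorphic to `A ^ d` as a left `A`-module. -/
def IsLeftFree (d : ℕ) : Prop :=
  letI := leftModule A P
  Nonempty (P ≃ₗ[A] (Fin d → A))

/-- `P` is isomorphic to `A ^ d` as a right `A`-module. -/
def IsRightFree (d : ℕ) : Prop :=
  letI := rightModule A P
  Nonempty (P ≃ₗ[Aᵐᵒᵖ] (Fin d → A))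

variable {P}

/-- The left action `a x`. -/
def lsmul (a : A) (x : P) : P := ((a ⊗ₜ[ℤ] (1 : Aᵐᵒᵖ) : Env A)) • x

/-- The right action `x a`. -/
def rsmul (x : P) (a : A) : P := (((1 : A) ⊗ₜ[ℤ] op a : Env A)) • x

end OneSided

/-! ### The regular bimodule -/

/-- A copy of `A`, regarded as an `A`-bimodule by left and right multiplication. -/
def RegBimod (A : Type u) : Type u := A

section Reg

variable (A : Type u) [Ring A]

instance : AddCommGroup (RegBimod A) := inferInstanceAs (AddCommGroup A)

instance : Module (Env A) (RegBimod A) :=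
  (TensorProduct.Algebra.module : Module (A ⊗[ℤ] Aᵐᵒᵖ) A)

/-- The identity map `A → RegBimod A`. -/
def RegBimod.of : A ≃+ RegBimod A := AddEquiv.refl A

theorem RegBimod.smul_of (a b x : A) :
    (a ⊗ₜ[ℤ] op b : Env A) • RegBimod.of A x = RegBimod.of A (a * x * b) := by
  rw [mul_assoc]
  exact TensorProduct.Algebra.smul_def a (op b) x

end Reg

/-! ### The tensor product of two bimodules -/

section Tensor

variable (A : Type u) [Ring A]
variable (P : Type v) [AddCommGroup P] [Module (Env A) P]
variable (Q : Type v) [AddCommGroup Q] [Module (Env A) Q]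

/-- The abelian group `P ⊗_ℤ Q`, regarded below as an `A`-bimodule by the left action of `A` on `P`
and the right action of `A` on `Q`. -/
def PreTensor (_A : Type u) (P Q : Type v) [AddCommGroup P] [AddCommGroup Q] : Type v := P ⊗[ℤ] Q

instance : AddCommGroup (PreTensor A P Q) := inferInstanceAs (AddCommGroup (P ⊗[ℤ] Q))

/-- The left action `a (x ⊗ y) = a x ⊗ y`. -/
abbrev PreTensor.leftAct : Module A (PreTensor A P Q) :=
  Module.compHom (P ⊗[ℤ] Q)
    (((Module.End.rTensorAlgHom ℤ P Q).toRingHom.comp (Module.toModuleEnd ℤ (S := Env A) P)).comp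
      (Algebra.TensorProduct.includeLeft : A →ₐ[ℤ] A ⊗[ℤ] Aᵐᵒᵖ).toRingHom)

/-- The right action `(x ⊗ y) b = x ⊗ y b`. -/
abbrev PreTensor.rightAct : Module Aᵐᵒᵖ (PreTensor A P Q) :=
  Module.compHom (P ⊗[ℤ] Q)
    (((Module.End.lTensorAlgHom ℤ Q P).toRingHom.comp (Module.toModuleEnd ℤ (S := Env A) Q)).comp
      (Algebra.TensorProduct.includeRight : Aᵐᵒᵖ →ₐ[ℤ] A ⊗[ℤ] Aᵐᵒᵖ).toRingHom)

instance : Module (Env A) (PreTensor A P Q) :=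
  letI := PreTensor.leftAct A P Q
  letI := PreTensor.rightAct A P Q
  haveI : SMulCommClass A Aᵐᵒᵖ (PreTensor A P Q) := ⟨fun a b t => by
    change P ⊗[ℤ] Q at t
    change LinearMap.rTensor Q (Module.toModuleEnd ℤ P (a ⊗ₜ[ℤ] (1 : Aᵐᵒᵖ) : Env A))
        (LinearMap.lTensor P (Module.toModuleEnd ℤ Q ((1 : A) ⊗ₜ[ℤ] b : Env A)) t) =
      LinearMap.lTensor P (Module.toModuleEnd ℤ Q ((1 : A) ⊗ₜ[ℤ] b : Env A))
        (LinearMap.rTensor Q (Module.toModuleEnd ℤ P (a ⊗ₜ[ℤ] (1 : Aᵐᵒᵖ) : Env A)) t)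
    rw [← LinearMap.comp_apply, ← LinearMap.comp_apply, LinearMap.rTensor_comp_lTensor,
      LinearMap.lTensor_comp_rTensor]⟩
  (TensorProduct.Algebra.module : Module (A ⊗[ℤ] Aᵐᵒᵖ) (PreTensor A P Q))

variable {P Q} in
/-- The element `x ⊗ y` of `P ⊗_ℤ Q`. -/
def PreTensor.tmul (x : P) (y : Q) : PreTensor A P Q := x ⊗ₜ[ℤ] y

variable {P Q} in
theorem PreTensor.smul_tmul (a b : A) (x : P) (y : Q) :
    ((a ⊗ₜ[ℤ] op b : Env A) • PreTensor.tmul A x y) =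
      PreTensor.tmul A (lsmul A a x) (rsmul A y b) := by
  let _ := PreTensor.leftAct A P Q
  let _ := PreTensor.rightAct A P Q
  rfl

/-- The sub-bimodule of `P ⊗_ℤ Q` generated by the elements `x a ⊗ y - x ⊗ a y`. -/
def balancingRelations : Submodule (Env A) (PreTensor A P Q) :=
  Submodule.span (Env A)
    {t | ∃ (x : P) (a : A) (y : Q),
      t = PreTensor.tmul A (rsmul A x a) y - PreTensor.tmul A x (lsmul A a y)}

/-- The tensor product `P ⊗_A Q` of two `A`-bimodules, an `A`-bimodule. -/
abbrev BimodTensor : Type v := PreTensor A P Q ⧸ balancingRelations A P Q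

end Tensor

/-! ### Weakly Galois bimodules -/

/-- The `A`-bimodule `P` is weakly Galois of rank `d`: `d ≥ 1`, `P ≅ A ^ d` as a left and as a right
`A`-module, and `P ⊗_A P` embeds, as a bimodule, into `P ^ N` for some `N`. -/
structure IsWeaklyGalois (A : Type u) [Ring A] (P : Type v) [AddCommGroup P] [Module (Env A) P]
    (d : ℕ) : Prop where
  one_le : 1 ≤ d
  leftFree : IsLeftFree A P d
  rightFree : IsRightFree A P d
  tensor_embeds : ∃ (N : ℕ) (f : BimodTensor A P P →ₗ[Env A] (Fin N → P)), Function.Injective f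

/-! ### Bimodules over a field -/

section Field

variable (L : Type u) [Field L] (P : Type v) [AddCommGroup P] [Module (Env L) P]

/-- The endomorphism `φ_P(a) : x ↦ x a` of the left `L`-vector space `P`. -/
def phi (a : L) : letI := leftModule L P; Module.End L P :=
  letI := leftModule L P
  { toFun := fun x => rsmul L x a
    map_add' := fun x y => smul_add _ x y
    map_smul' := fun c x => by
      change ((1 : L) ⊗ₜ[ℤ] op a : Env L) • ((c ⊗ₜ[ℤ] (1 : Lᵐᵒᵖ) : Env L) • x) =
        (c ⊗ₜ[ℤ] (1 : Lᵐᵒᵖ) : Env L) • (((1 : L) ⊗ₜ[ℤ] op a : Env L) • x)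
      simp [← mul_smul] }

/-- The bimodule `P` is split: for each `a`, all eigenvalues of `φ_P(a)` (in an algebraic closure of
`L`) lie in `L`. -/
def IsSplit : Prop :=
  letI := leftModule L P
  ∀ (a : L) (μ : AlgebraicClosure L),
    Module.End.HasEigenvalue ((phi L P a).baseChange (AlgebraicClosure L)) μ →
      μ ∈ (algebraMap L (AlgebraicClosure L)).range

/-- The center of `P`: the subfield of all `z ∈ L` with `z x = x z` for all `x ∈ P`. -/
def center : Subfield L where
  carrier := {z | ∀ x : P, lsmul L z x = rsmul L x z}
  mul_mem' := by
    intro a b ha hb x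
    have h1 : lsmul L (a * b) x = lsmul L a (lsmul L b x) := by
      simp [lsmul, ← mul_smul]
    have h2 : rsmul L x (a * b) = rsmul L (rsmul L x a) b := by
      simp [rsmul, ← mul_smul]
    rw [h1, h2, hb, ha]
    simp only [rsmul, ← mul_smul, Algebra.TensorProduct.tmul_mul_tmul, ← op_mul, mul_comm]
  one_mem' := by
    intro x
    simp [lsmul, rsmul]
  add_mem' := by
    intro a b ha hb x
    have h1 : lsmul L (a + b) x = lsmul L a x + lsmul L b x := by
      simp [lsmul, TensorProduct.add_tmul, add_smul]
    have h2 : rsmul L x (a + b) = rsmul L x a + rsmul L x b := by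
      simp [rsmul, TensorProduct.tmul_add, add_smul]
    rw [h1, h2, ha, hb]
  zero_mem' := by
    intro x
    simp [lsmul, rsmul]
  neg_mem' := by
    intro a ha x
    have h1 : lsmul L (-a) x = - lsmul L a x := by
      simp [lsmul, TensorProduct.neg_tmul, neg_smul]
    have h2 : rsmul L x (-a) = - rsmul L x a := by
      simp [rsmul, TensorProduct.tmul_neg, neg_smul]
    rw [h1, h2, ha]
  inv_mem' := by
    intro a ha x
    rcases eq_or_ne a 0 with rfl | h0
    · simp [lsmul, rsmul]
    · have h1 : lsmul L a⁻¹ (lsmul L a (rsmul L x a⁻¹)) = rsmul L x a⁻¹ := by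
        simp [lsmul, ← mul_smul, h0, ← Algebra.TensorProduct.one_def]
      have h2 : rsmul L (rsmul L x a⁻¹) a = x := by
        simp [rsmul, ← mul_smul, h0, ← Algebra.TensorProduct.one_def]
      rw [ha, h2] at h1
      exact h1

/-! ### The socle filtration -/

section Socle

variable (R : Type u) [Ring R] (M : Type v) [AddCommGroup M] [Module R M]

/-- The socle of a module: the sum of its simple submodules. -/
def socle : Submodule R M := sSup {S | IsSimpleModule R S}

/-- The socle filtration: `F₀ = 0` and `F_{i+1} / F_i` is the socle of `M / F_i`. -/
def socleFiltration : ℕ → Submodule R M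
  | 0 => ⊥
  | i + 1 => (socle R (M ⧸ socleFiltration i)).comap (socleFiltration i).mkQ

/-- The associated graded module `⨁ᵢ F_{i+1} / F_i` of the socle filtration. -/
abbrev socleGr : Type v :=
  ⨁ i : ℕ, (socleFiltration R M (i + 1)) ⧸
    (socleFiltration R M i).submoduleOf (socleFiltration R M (i + 1))

end Socle

/-- `P` is a purely inseparable weakly Galois `L`-bimodule of rank `d`: it is weakly Galois of rank
`d`, split, and `gr(P) ≅ L ^ d` as a bimodule, for the socle filtration of `P` as a bimodule. -/
structure IsPurelyInseparableWeaklyGalois (d : ℕ) : Prop where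
  weaklyGalois : IsWeaklyGalois L P d
  split : IsSplit L P
  gr_trivial : Nonempty (socleGr (Env L) P ≃ₗ[Env L] (Fin d → RegBimod L))

/-! ### The bimodule `L ⊗_K L` -/

/-- The abelian group `L ⊗_K L` for a subfield `K` of `L`, regarded below as an `L`-bimodule by
multiplication on the left in the first factor and on the right in the second. -/
def FieldTensor {L : Type u} [Field L] (K : Subfield L) : Type u := L ⊗[K] L

instance (K : Subfield L) : AddCommGroup (FieldTensor K) := inferInstanceAs (AddCommGroup (L ⊗[K] L))

/-- The ring homomorphism `L ⊗_ℤ Lᵐᵒᵖ → L ⊗_K L`, `a ⊗ op b ↦ a ⊗ b`. -/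
def envToFieldTensor (K : Subfield L) : Env L →ₐ[ℤ] L ⊗[K] L :=
  Algebra.TensorProduct.lift
    ((Algebra.TensorProduct.includeLeft : L →ₐ[K] L ⊗[K] L).restrictScalars ℤ)
    (((Algebra.TensorProduct.includeRight : L →ₐ[K] L ⊗[K] L).restrictScalars ℤ).comp
      (AlgEquiv.toOpposite ℤ L).symm.toAlgHom)
    (fun _ _ => Commute.all _ _)

instance (K : Subfield L) : Module (Env L) (FieldTensor K) :=
  Module.compHom (L ⊗[K] L) (envToFieldTensor L K).toRingHom

/-- The identity map `L ⊗_K L → FieldTensor K`. -/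
def FieldTensor.of (K : Subfield L) : L ⊗[K] L ≃+ FieldTensor K := AddEquiv.refl _

theorem FieldTensor.smul_of (K : Subfield L) (a b x y : L) :
    (a ⊗ₜ[ℤ] op b : Env L) • FieldTensor.of L K (x ⊗ₜ[K] y) =
      FieldTensor.of L K ((a * x) ⊗ₜ[K] (y * b)) := by
  change envToFieldTensor L K (a ⊗ₜ[ℤ] op b) * (x ⊗ₜ[K] y) = (a * x) ⊗ₜ[K] (y * b)
  rw [mul_comm y b]
  simp [envToFieldTensor]

end Field

end GaloisBimodule

end

/-! Write `K` for the center. The embedding of `P ⊗_L P` into `P ^ N` forces `L ⊗_K L` to act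
faithfully on `P` (`IsWeaklyGalois.coeff_eq_zero`): a shortest relation, contracted along right
linear functionals, has central coefficients. Hence `L ⊗_K L` embeds into the finite-dimensional
space `End_L(P)`, and `L` is finite over `K`.

Triviality of `gr(P)` makes every `a ⊗ 1 - 1 ⊗ a` nilpotent on `P` (`exists_commutator_pow`). If `a`
is separable over `K`, right multiplication by `a` is annihilated by a separable polynomial and by a
power of `X - a`, so it equals left multiplication and `a ∈ K`.

By faithfulness these commutators are nilpotent on `L ⊗_K L` too, so they vanish on its simple
sub-bimodules. The elements they kill form a left `L`-space of dimension at most one, so a single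
nonzero `s₀` lies in every nonzero sub-bimodule. If no orbit map `x ⊗ y ↦ x p y` were injective, all
of them would kill `s₀`, contradicting faithfulness. -/

namespace GaloisBimodule

universe u v

/-! ### Faithfulness of the operator ring and finiteness over the center. -/

section Operators
variable {L : Type u} [Field L] {P : Type v} [AddCommGroup P] [Module (Env L) P]

theorem tmul_op_mul (a b c e : L) :
    (a ⊗ₜ[ℤ] op b : Env L) * (c ⊗ₜ[ℤ] op e) = (a * c) ⊗ₜ[ℤ] op (b * e) := by
  rw [Algebra.TensorProduct.tmul_mul_tmul, ← op_mul, mul_comm e b]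

theorem tmul_op_smul (a b : L) (x : P) :
    (a ⊗ₜ[ℤ] op b : Env L) • x = lsmul L a (rsmul L x b) := by
  simp [lsmul, rsmul, ← mul_smul]

theorem tmul_op_smul' (a b : L) (x : P) :
    (a ⊗ₜ[ℤ] op b : Env L) • x = rsmul L (lsmul L a x) b := by
  simp [lsmul, rsmul, ← mul_smul]

theorem lsmul_lsmul (a b : L) (x : P) : lsmul L a (lsmul L b x) = lsmul L (a * b) x := by
  simp [lsmul, ← mul_smul]

theorem lsmul_tmul_op_smul (c a b : L) (x : P) :
    lsmul L c ((a ⊗ₜ[ℤ] op b : Env L) • x) = ((c * a) ⊗ₜ[ℤ] op b : Env L) • x := by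
  simp [lsmul, ← mul_smul]

theorem center_tmul_op_smul {z : L} (hz : z ∈ center L P) (a b : L) (x : P) :
    (a ⊗ₜ[ℤ] op (z * b) : Env L) • x = ((a * z) ⊗ₜ[ℤ] op b : Env L) • x := by
  have h1 : (a ⊗ₜ[ℤ] op (z * b) : Env L) = (a ⊗ₜ[ℤ] op b) * (1 ⊗ₜ[ℤ] op z) := by
    rw [tmul_op_mul, mul_one, mul_comm z]
  have h2 : ((a * z) ⊗ₜ[ℤ] op b : Env L) = (a ⊗ₜ[ℤ] op b) * (z ⊗ₜ[ℤ] op 1) := by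
    rw [tmul_op_mul, mul_one]
  rw [h1, h2, mul_smul, mul_smul]
  exact congrArg _ (hz x).symm

/-- A right linear functional `ψ` on `P` induces `x ⊗ y ↦ ψ(x) y` on `P ⊗_L Q`. -/
theorem exists_contraction {Q : Type v} [AddCommGroup Q] [Module (Env L) Q]
    (ψ : P →+ L) (hψ : ∀ x a, ψ (rsmul L x a) = ψ x * a) :
    ∃ T : BimodTensor L P Q →+ Q, ∀ x y,
      T (Submodule.Quotient.mk (PreTensor.tmul L x y)) = lsmul L (ψ x) y := by
  let lact : L →+ Q →+ Q := AddMonoidHom.mk' (fun a => AddMonoidHom.mk' (fun y => lsmul L a y)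
    fun _ _ => smul_add _ _ _) fun a b => by
      ext y; simp [lsmul, TensorProduct.add_tmul, add_smul]
  let B : P →+ Q →+ Q := lact.comp ψ
  let T₀ : PreTensor L P Q →+ Q :=
    (TensorProduct.liftAddHom B (fun r x y => by simp) : P ⊗[ℤ] Q →+ Q)
  have hT₀ : ∀ x y, T₀ (PreTensor.tmul L x y) = lsmul L (ψ x) y := fun x y =>
    TensorProduct.liftAddHom_tmul _ _ _ _
  -- `T₀` need not be left linear, since `ψ` is only right linear. Quantifying over `r` makes the
  -- induction on the `Env L`-span go through.
  have hker : ∀ t ∈ balancingRelations L P Q, ∀ r : Env L, T₀ (r • t) = 0 := by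
    intro t ht
    refine Submodule.span_induction (p := fun t _ => ∀ r : Env L, T₀ (r • t) = 0)
      ?_ ?_ ?_ ?_ ht
    · rintro _ ⟨x, a, y, rfl⟩ r
      induction r using TensorProduct.induction_on with
      | zero => simp
      | add r s hr hs => rw [add_smul, map_add, hr, hs, add_zero]
      | tmul c e =>
        obtain ⟨e, rfl⟩ := op_surjective e
        rw [smul_sub, PreTensor.smul_tmul, PreTensor.smul_tmul, map_sub, hT₀, hT₀]
        rw [← tmul_op_smul c a x, tmul_op_smul', hψ, ← lsmul_lsmul, ← tmul_op_smul a e y,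
          tmul_op_smul', sub_self]
    · simp
    · intro x y _ _ hx hy r
      rw [smul_add, map_add, hx, hy, add_zero]
    · intro c x _ hx r
      rw [← mul_smul]; exact hx _
  refine ⟨QuotientAddGroup.lift (balancingRelations L P Q).toAddSubgroup T₀ fun t ht => ?_, ?_⟩
  · simpa using hker t ht 1
  · intro x y
    exact hT₀ x y

/-- The coordinates of a right basis separate points, so identities in `P` can be tested on
functionals that contract tensors. -/
theorem IsRightFree.eq_zero_of_forall {d : ℕ} (h : IsRightFree L P d) {x : P}
    (hx : ∀ ψ : P →+ L, (∀ x a, ψ (rsmul L x a) = ψ x * a) → ψ x = 0) : x = 0 := by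
  let _ := rightModule L P
  obtain ⟨e⟩ : Nonempty (P ≃ₗ[Lᵐᵒᵖ] (Fin d → L)) := h
  refine e.injective ?_
  rw [map_zero]
  funext i
  refine hx ((Pi.evalAddMonoidHom (fun _ : Fin d => L) i).comp e.toAddEquiv.toAddMonoidHom) ?_
  intro x a
  exact congrFun (e.map_smul (op a) x) i

theorem IsLeftFree.nontrivial {d : ℕ} (h : IsLeftFree L P d) (hd : 1 ≤ d) : Nontrivial P := by
  let _ := leftModule L P
  obtain ⟨e⟩ : Nonempty (P ≃ₗ[L] (Fin d → L)) := h
  have : Nonempty (Fin d) := ⟨⟨0, hd⟩⟩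
  exact e.toEquiv.nontrivial

theorem eq_zero_of_rsmul_eq_zero [Nontrivial P] {c : L} (h : ∀ p : P, rsmul L p c = 0) :
    c = 0 := by
  by_contra hc
  obtain ⟨p, hp⟩ := exists_ne (0 : P)
  have h1 := h (rsmul L p c⁻¹)
  apply hp
  simpa [rsmul, ← mul_smul, hc, ← op_mul, ← Algebra.TensorProduct.one_def, -op_inv] using h1

/-- The comultiplication on the ring of operators of a bimodule with `P ⊗_L P ⊆ P ^ N`. -/
theorem IsWeaklyGalois.sum_contraction {d : ℕ} (hP : IsWeaklyGalois L P d) {ι : Type*}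
    (s : Finset ι) (a b : ι → L) (h : ∀ p : P, ∑ i ∈ s, (a i ⊗ₜ[ℤ] op (b i) : Env L) • p = 0)
    (ψ : P →+ L) (hψ : ∀ x a, ψ (rsmul L x a) = ψ x * a) (p q : P) :
    ∑ i ∈ s, (ψ (lsmul L (a i) p) ⊗ₜ[ℤ] op (b i) : Env L) • q = 0 := by
  obtain ⟨N, f, hf⟩ := hP.tensor_embeds
  obtain ⟨T, hT⟩ := exists_contraction (Q := P) ψ hψ
  -- An operator that kills `P` kills `P ^ N`, hence also `P ⊗_L P`.
  have h0 : ∑ i ∈ s, (a i ⊗ₜ[ℤ] op (b i) : Env L) •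
      (Submodule.Quotient.mk (PreTensor.tmul L p q) : BimodTensor L P P) = 0 := by
    apply hf
    rw [map_zero, map_sum]
    funext n
    simpa only [map_smul, Finset.sum_apply, Pi.smul_apply, Pi.zero_apply] using h _
  have h1 := congrArg T h0
  rw [map_zero, map_sum] at h1
  rw [← h1]
  refine Finset.sum_congr rfl fun i _ => ?_
  rw [← Submodule.Quotient.mk_smul, PreTensor.smul_tmul, hT, tmul_op_smul]

/-- Operators `∑ aᵢ ⊗ bᵢ` with `bᵢ` linearly independent over the center act nontrivially. -/
theorem IsWeaklyGalois.coeff_eq_zero {d : ℕ} (hP : IsWeaklyGalois L P d) {ι : Type*} {b : ι → L}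
    (hb : LinearIndependent (center L P) b) (s : Finset ι) (a : ι → L)
    (h : ∀ p : P, ∑ i ∈ s, (a i ⊗ₜ[ℤ] op (b i) : Env L) • p = 0) : ∀ i ∈ s, a i = 0 := by
  classical
  have := hP.leftFree.nontrivial hP.one_le
  induction s using Finset.induction_on generalizing a with
  | empty => simp
  | insert j s hj ih =>
    by_cases haj : a j = 0
    · have := ih a fun p => by simpa [Finset.sum_insert hj, haj] using h p
      intro i hi
      rcases Finset.mem_insert.1 hi with rfl | hi
      exacts [haj, this i hi]
    exfalso
    -- Normalizing one coefficient to `1` lets it cancel below, as in Artin's proof of independence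
    -- of characters.
    let c : ι → L := fun i => (a j)⁻¹ * a i
    have hcj : c j = 1 := inv_mul_cancel₀ haj
    have hc : ∀ p : P, ∑ i ∈ insert j s, (c i ⊗ₜ[ℤ] op (b i) : Env L) • p = 0 := by
      intro p
      have := congrArg (lsmul L (a j)⁻¹) (h p)
      simp only [lsmul, Finset.smul_sum, smul_zero] at this
      rw [← this]
      refine Finset.sum_congr rfl fun i _ => ?_
      rw [← mul_smul]
      simp [c]
    have hmem : ∀ i ∈ insert j s, c i ∈ center L P := by
      intro i hi
      rcases Finset.mem_insert.1 hi with rfl | hi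
      · rw [hcj]; exact one_mem _
      intro p
      rw [← sub_eq_zero]
      refine hP.rightFree.eq_zero_of_forall fun ψ hψ => ?_
      -- The contracted relation minus `ψ p` times the original one has no `j` term. The shorter
      -- relation is trivial, so `ψ (c i p) = ψ (p c i)` for every `ψ`.
      have key := ih (fun i => ψ (lsmul L (c i) p) - ψ p * c i) (fun q => ?_) i hi
      · rw [map_sub, hψ, key]
      have h1 := hP.sum_contraction _ c b hc ψ hψ p q
      have h2 : ∑ i ∈ insert j s, ((ψ p * c i) ⊗ₜ[ℤ] op (b i) : Env L) • q = 0 := by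
        have := congrArg (lsmul L (ψ p)) (hc q)
        simp only [lsmul, Finset.smul_sum, smul_zero] at this
        rw [← this]
        refine Finset.sum_congr rfl fun i _ => ?_
        rw [← mul_smul]
        simp
      have h3 := sub_eq_zero_of_eq (h1.trans h2.symm)
      rw [← Finset.sum_sub_distrib, Finset.sum_insert hj, hcj] at h3
      have h4 : lsmul L (1 : L) p = p := by
        simp [lsmul, ← Algebra.TensorProduct.one_def]
      rw [h4, mul_one, sub_self, zero_add] at h3
      rw [← h3]
      simp only [TensorProduct.sub_tmul, sub_smul]
    -- Central coefficients move to the right, so the relation is right multiplication by a single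
    -- scalar, which must vanish.
    have hsum : ∑ i ∈ insert j s, c i * b i = 0 := by
      refine eq_zero_of_rsmul_eq_zero (P := P) fun p => ?_
      rw [← hc p, rsmul, Finset.op_sum, TensorProduct.tmul_sum, Finset.sum_smul]
      refine Finset.sum_congr rfl fun i hi => ?_
      rw [center_tmul_op_smul (hmem i hi), one_mul]
    have hzero := linearIndependent_iff'.1 hb (insert j s)
      (fun i => if hi : i ∈ insert j s then ⟨c i, hmem i hi⟩ else 0) (by
        rw [← hsum]
        refine Finset.sum_congr rfl fun i hi => ?_
        rw [dif_pos hi]; rfl) j (Finset.mem_insert_self j s)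
    rw [dif_pos (Finset.mem_insert_self j s)] at hzero
    exact one_ne_zero (hcj.symm.trans (congrArg Subtype.val hzero))

/-- Right multiplications by a `K`-basis of `L` are linearly independent in `End_L(P)`, which has
finite dimension over `L`. -/
theorem IsWeaklyGalois.finiteDimensional_center {d : ℕ} (hP : IsWeaklyGalois L P d) :
    FiniteDimensional (center L P) L := by
  let _ := leftModule L P
  obtain ⟨e⟩ : Nonempty (P ≃ₗ[L] (Fin d → L)) := hP.leftFree
  have : Module.Finite L P := Module.Finite.equiv e.symm
  let B := Module.Basis.ofVectorSpace (center L P) L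
  have hind : LinearIndependent L fun i => phi L P (B i) := by
    rw [linearIndependent_iff']
    intro s a h
    refine hP.coeff_eq_zero B.linearIndependent s a fun p => ?_
    have := LinearMap.congr_fun h p
    rw [LinearMap.sum_apply, LinearMap.zero_apply] at this
    rw [← this]
    refine Finset.sum_congr rfl fun i _ => ?_
    rw [tmul_op_smul]
    rfl
  have : Finite (Module.Basis.ofVectorSpaceIndex (center L P) L) := hind.finite
  exact Module.Finite.of_basis B

end Operators

/-! ### Nilpotent commutators and pure inseparability. -/

section Nilpotence

section Socle

variable {R : Type u} [CommRing R] {M : Type v} [AddCommGroup M] [Module R M]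

theorem socle_ne_bot [IsArtinian R M] [Nontrivial M] : socle R M ≠ ⊥ := by
  obtain ⟨S, hS, -⟩ := (eq_bot_or_exists_atom_le (⊤ : Submodule R M)).resolve_left top_ne_bot
  intro h
  have : S ≤ socle R M := le_sSup (isSimpleModule_iff_isAtom.2 hS)
  exact hS.1 (le_bot_iff.1 (h ▸ this))

theorem socleFiltration_le_succ (i : ℕ) : socleFiltration R M i ≤ socleFiltration R M (i + 1) := by
  intro x hx
  have h0 : (socleFiltration R M i).mkQ x = 0 := (Submodule.Quotient.mk_eq_zero _).2 hx
  change (socleFiltration R M i).mkQ x ∈ socle R (M ⧸ socleFiltration R M i)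
  rw [h0]
  exact zero_mem _

/-- Where the filtration stabilizes, the quotient has zero socle. A nonzero Artinian module contains
a simple submodule, so that quotient is zero. -/
theorem exists_socleFiltration_eq_top [IsArtinian R M] [IsNoetherian R M] :
    ∃ n, socleFiltration R M n = ⊤ := by
  obtain ⟨n, hn⟩ := monotone_stabilizes_iff_noetherian.2 ‹IsNoetherian R M›
    ⟨socleFiltration R M, monotone_nat_of_le_succ socleFiltration_le_succ⟩
  refine ⟨n, ?_⟩
  by_contra h
  have : Nontrivial (M ⧸ socleFiltration R M n) := Submodule.Quotient.nontrivial_iff.2 h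
  apply socle_ne_bot (R := R) (M := M ⧸ socleFiltration R M n)
  rw [eq_bot_iff]
  intro y hy
  obtain ⟨x, rfl⟩ := Submodule.mkQ_surjective _ y
  have hx : x ∈ socleFiltration R M (n + 1) := hy
  have hn' : socleFiltration R M n = socleFiltration R M (n + 1) := hn (n + 1) n.le_succ
  rw [← hn'] at hx
  exact (Submodule.Quotient.mk_eq_zero _).2 hx

/-- A scalar that kills the graded module lowers the filtration by one step, and the filtration is
finite. -/
theorem pow_smul_eq_zero_of_socleGr [IsArtinian R M] [IsNoetherian R M] {r : R}
    (h : ∀ y : socleGr R M, r • y = 0) : ∃ n, ∀ x : M, r ^ n • x = 0 := by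
  classical
  have step : ∀ i, ∀ x ∈ socleFiltration R M (i + 1), r • x ∈ socleFiltration R M i := by
    intro i x hx
    have h1 := h (DirectSum.lof R ℕ (fun i : ℕ => (socleFiltration R M (i + 1)) ⧸
      (socleFiltration R M i).submoduleOf (socleFiltration R M (i + 1))) i
      (Submodule.Quotient.mk ⟨x, hx⟩))
    rw [← map_smul, ← map_zero (DirectSum.lof R ℕ (fun i : ℕ => (socleFiltration R M (i + 1)) ⧸
      (socleFiltration R M i).submoduleOf (socleFiltration R M (i + 1))) i)] at h1
    have h2 := DirectSum.of_injective (β := fun i : ℕ => (socleFiltration R M (i + 1)) ⧸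
      (socleFiltration R M i).submoduleOf (socleFiltration R M (i + 1))) i h1
    rw [← Submodule.Quotient.mk_smul, Submodule.Quotient.mk_eq_zero] at h2
    exact h2
  have hpow : ∀ n, ∀ x ∈ socleFiltration R M n, r ^ n • x = 0 := by
    intro n
    induction n with
    | zero => intro x hx; simpa using (Submodule.mem_bot R).1 hx
    | succ n ih => intro x hx; rw [pow_succ, mul_smul]; exact ih _ (step n x hx)
  obtain ⟨n, hn⟩ := exists_socleFiltration_eq_top (R := R) (M := M)
  exact ⟨n, fun x => hpow n x (hn ▸ trivial)⟩

/-- Schur's lemma for a nilpotent scalar. -/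
theorem smul_eq_zero_of_isAtom {S : Submodule R M} (hS : IsAtom S) {r : R} {n : ℕ}
    (h : ∀ x ∈ S, r ^ n • x = 0) : ∀ x ∈ S, r • x = 0 := by
  by_cases hd : LinearMap.ker (LinearMap.lsmul R M r) ⊓ S = ⊥
  · exfalso
    have inj : ∀ x ∈ S, r • x = 0 → x = 0 := fun x hx h0 =>
      (Submodule.mem_bot R).1 (hd ▸ ⟨h0, hx⟩)
    apply hS.1
    rw [eq_bot_iff]
    intro x hx
    have : ∀ n, ∀ x ∈ S, r ^ n • x = 0 → x = 0 := by
      intro n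
      induction n with
      | zero => intro x _ h; simpa using h
      | succ n ih =>
        intro x hx h
        rw [pow_succ, mul_smul] at h
        exact inj x hx (ih _ (S.smul_mem r hx) h)
    exact this n x hx (h x hx)
  · intro x hx
    have := (hS.le_iff.1 (inf_le_right :
      LinearMap.ker (LinearMap.lsmul R M r) ⊓ S ≤ S)).resolve_left hd
    rw [← this] at hx
    exact hx.1

end Socle

section Field

variable {L : Type u} [Field L]

/-- The element `a ⊗ 1 - 1 ⊗ a`, acting as the commutator with `a`. -/
def commutator (a : L) : Env L := a ⊗ₜ[ℤ] op 1 - 1 ⊗ₜ[ℤ] op a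

section

variable {P : Type v} [AddCommGroup P] [Module (Env L) P]

theorem commutator_smul (a : L) (x : P) : commutator a • x = lsmul L a x - rsmul L x a :=
  sub_smul _ _ _

theorem leftModule_isScalarTower :
    letI := leftModule L P
    IsScalarTower L (Env L) P :=
  letI := leftModule L P
  ⟨fun a r x => by
    change (a • r) • x = ((a ⊗ₜ[ℤ] (1 : Lᵐᵒᵖ) : Env L)) • r • x
    rw [← mul_smul, Algebra.smul_def, Algebra.TensorProduct.algebraMap_apply]
    rfl⟩

theorem isArtinian_env (h : letI := leftModule L P; Module.Finite L P) :
    IsArtinian (Env L) P := by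
  let _ := leftModule L P
  have := leftModule_isScalarTower (L := L) (P := P)
  exact isArtinian_of_tower L inferInstance

theorem isNoetherian_env (h : letI := leftModule L P; Module.Finite L P) :
    IsNoetherian (Env L) P := by
  let _ := leftModule L P
  have := leftModule_isScalarTower (L := L) (P := P)
  exact isNoetherian_of_tower L inferInstance

theorem IsLeftFree.finite {d : ℕ} (h : IsLeftFree L P d) :
    letI := leftModule L P
    Module.Finite L P := by
  let _ := leftModule L P
  obtain ⟨e⟩ : Nonempty (P ≃ₗ[L] (Fin d → L)) := h
  exact Module.Finite.equiv e.symm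

/-- Commutators act by zero on the regular bimodule because `L` is commutative, hence also on
`gr(P)`. -/
theorem IsPurelyInseparableWeaklyGalois.exists_commutator_pow {d : ℕ}
    (h : IsPurelyInseparableWeaklyGalois L P d) (a : L) :
    ∃ n, ∀ x : P, commutator a ^ n • x = 0 := by
  have hfin := h.weaklyGalois.leftFree.finite
  have := isArtinian_env hfin
  have := isNoetherian_env hfin
  obtain ⟨e⟩ := h.gr_trivial
  refine pow_smul_eq_zero_of_socleGr fun y => e.injective ?_
  rw [map_smul, map_zero]
  funext i
  obtain ⟨c, hc⟩ := RegBimod.of L |>.surjective (e y i)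
  rw [Pi.smul_apply, ← hc, commutator, sub_smul, RegBimod.smul_of, RegBimod.smul_of, mul_one,
    one_mul, mul_comm, sub_self]
  rfl

open Polynomial in
theorem IsPurelyInseparableWeaklyGalois.isPurelyInseparable_center {d : ℕ}
    (h : IsPurelyInseparableWeaklyGalois L P d) :
    IsPurelyInseparable (center L P) L := by
  have := h.weaklyGalois.finiteDimensional_center
  refine ⟨inferInstance, fun a hsep => ⟨⟨a, ?_⟩, rfl⟩⟩
  let _ := leftModule L P
  set f := (minpoly (center L P) a).map (algebraMap (center L P) L) with hf
  obtain ⟨g, hg⟩ : X - C a ∣ f := by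
    rw [dvd_iff_isRoot, IsRoot.def, hf, eval_map_algebraMap, minpoly.aeval]
  have hfs : f.Separable := Polynomial.Separable.map (p := minpoly _ a) hsep
  obtain ⟨n, hn⟩ := h.exists_commutator_pow a
  have hcop : IsCoprime ((X - C a) ^ n) g := by
    rw [hg] at hfs
    exact hfs.isCoprime.pow_left
  obtain ⟨u, v, huv⟩ := hcop
  let T : Module.End L P := phi L P a
  have hpow : ∀ k x, (T ^ k) x = ((1 : L) ⊗ₜ[ℤ] op (a ^ k) : Env L) • x := by
    intro k
    induction k with
    | zero => intro x; simp [← Algebra.TensorProduct.one_def]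
    | succ k ih =>
      intro x
      rw [pow_succ, Module.End.mul_apply, ih]
      change _ • ((1 : L) ⊗ₜ[ℤ] op a : Env L) • x = _
      rw [← mul_smul, tmul_op_mul, mul_one, pow_succ]
  -- The coefficients of `f` are central, so their left action in `aeval T f` may be replaced by the
  -- right action. This gives right multiplication by `f(a) = 0`.
  have hfT : aeval T f = 0 := by
    ext x
    rw [hf, aeval_eq_sum_range, LinearMap.sum_apply, LinearMap.zero_apply]
    have h0 : ((1 : L) ⊗ₜ[ℤ] op (aeval a (minpoly (center L P) a)) : Env L) • x = 0 := by
      rw [minpoly.aeval]; simp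
    rw [aeval_eq_sum_range, Finset.op_sum, TensorProduct.tmul_sum, Finset.sum_smul] at h0
    rw [← h0, natDegree_map]
    refine Finset.sum_congr rfl fun k _ => ?_
    rw [LinearMap.smul_apply, hpow, coeff_map]
    rw [Algebra.smul_def]
    refine Eq.trans ?_ (center_tmul_op_smul ((minpoly (center L P) a).coeff k).2 1 (a ^ k) x).symm
    rw [one_mul]
    change lsmul L _ _ = _
    rw [lsmul_tmul_op_smul, mul_one]
    rfl
  have hXT : ∀ x, (aeval T (X - C a)) x = - (commutator a • x) := by
    intro x
    rw [commutator_smul, map_sub, aeval_X, aeval_C, neg_sub]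
    rfl
  have hXTn : aeval T ((X - C a) ^ n) = 0 := by
    have : ∀ k x, (aeval T ((X - C a) ^ k)) x = (-1) ^ k • (commutator a ^ k • x) := by
      intro k
      induction k with
      | zero => intro x; simp
      | succ k ih =>
        intro x
        rw [pow_succ, map_mul, Module.End.mul_apply, ih, hXT, smul_neg, ← mul_smul, ← pow_succ,
          pow_succ (-1 : ℤ), mul_smul, neg_one_smul, smul_neg]
    ext x
    rw [this, hn, smul_zero, LinearMap.zero_apply]
  -- Multiplying the Bézout identity for `(X - a) ^ n` and `g` by `X - a` writes `X - a` as a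
  -- combination of two polynomials that annihilate `T`.
  have hzero : aeval T (X - C a) = 0 := by
    have h1 : (X - C a) = (X - C a) * u * (X - C a) ^ n + v * f := by
      rw [hg]
      linear_combination (-(X - C a)) * huv
    rw [h1, map_add, map_mul, map_mul _ v f, hXTn, hfT, mul_zero, mul_zero, add_zero]
  intro x
  have := hXT x
  rw [hzero, LinearMap.zero_apply, eq_comm, neg_eq_zero, commutator_smul, sub_eq_zero] at this
  exact this

end

end Field
end Nilpotence

/-! ### Embedding `L ⊗_K L` into `P`. -/

section Embedding

section FieldExtension

variable {K L : Type*} [Field K] [Field L] [Algebra K L]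

theorem eq_sum_baseChange_basis {ι : Type*} [Fintype ι] (b : Module.Basis ι K L) (t : L ⊗[K] L) :
    t = ∑ i, (b.baseChange L).repr t i ⊗ₜ[K] b i := by
  conv_lhs => rw [← (b.baseChange L).sum_repr t]
  refine Finset.sum_congr rfl fun i _ => ?_
  rw [Module.Basis.baseChange_apply, TensorProduct.smul_tmul', smul_eq_mul, mul_one]

/-- The form `(y, x) ↦ l (y * x)` is nondegenerate because nonzero elements of `L` are invertible.
Equality of dimensions then gives surjectivity onto the dual. -/
theorem exists_mul_eq_functional [FiniteDimensional K L] {l : L →ₗ[K] K} (hl : l ≠ 0)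
    (μ : L →ₗ[K] K) : ∃ y : L, ∀ x, l (y * x) = μ x := by
  let Φ : L →ₗ[K] Module.Dual K L := (LinearMap.mul K L).compr₂ l
  have hinj : Function.Injective Φ := by
    rw [← LinearMap.ker_eq_bot, eq_bot_iff]
    intro y hy
    by_contra hy0
    refine hl (LinearMap.ext fun x => ?_)
    have := LinearMap.congr_fun (LinearMap.mem_ker.1 hy) (y⁻¹ * x)
    change l (y * (y⁻¹ * x)) = 0 at this
    rwa [mul_inv_cancel_left₀ hy0] at this
  obtain ⟨y, hy⟩ := (LinearMap.injective_iff_surjective_of_finrank_eq_finrank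
    (Subspace.dual_finrank_eq (K := K) (V := L)).symm).1 hinj μ
  exact ⟨y, fun x => LinearMap.congr_fun hy x⟩

/-- The elements of `L ⊗_K L` on which both actions of `L` agree form a space of dimension at
most one, on which a suitable left linear functional is injective. -/
theorem exists_functional_tensor [FiniteDimensional K L] :
    ∃ τ : L ⊗[K] L →ₗ[L] L, ∀ s : L ⊗[K] L,
      (∀ a : L, a ⊗ₜ[K] (1 : L) * s = (1 : L) ⊗ₜ[K] a * s) → τ s = 0 → s = 0 := by
  classical
  let b := Module.finBasis K L
  obtain ⟨i₀⟩ : Nonempty (Fin (Module.finrank K L)) := ⟨⟨0, Module.finrank_pos⟩⟩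
  let l : L →ₗ[K] K := b.coord i₀
  have hl : l ≠ 0 := fun h => by
    have := LinearMap.congr_fun h (b i₀)
    simp [l] at this
  let τ : L ⊗[K] L →ₗ[L] L :=
    (TensorProduct.AlgebraTensorModule.rid K L L).toLinearMap ∘ₗ l.baseChange L
  have hτ : ∀ x y, τ (x ⊗ₜ y) = l y • x := fun x y => by
    simp [τ]
  refine ⟨τ, fun s hs h0 => ?_⟩
  -- On such `s`, right multiplication by `y` agrees with left multiplication, which commutes with
  -- `τ`.
  have h1 : ∀ y, τ ((1 : L) ⊗ₜ[K] y * s) = 0 := fun y => by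
    have h2 : y ⊗ₜ[K] (1 : L) * s = y • s := by
      rw [Algebra.smul_def, Algebra.TensorProduct.algebraMap_apply]
      rfl
    rw [← hs y, h2, map_smul, h0, smul_zero]
  have hcoeff : ∀ j, (b.baseChange L).repr s j = 0 := by
    intro j
    -- With this `y`, the map `t ↦ τ ((1 ⊗ y) * t)` reads off the `j`-th coordinate.
    obtain ⟨y, hy⟩ := exists_mul_eq_functional hl (b.coord j)
    have h3 := h1 y
    rw [eq_sum_baseChange_basis b s, Finset.mul_sum, map_sum] at h3
    simp only [Algebra.TensorProduct.tmul_mul_tmul, one_mul, hτ, hy] at h3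
    simpa [Finsupp.single_apply] using h3
  rw [eq_sum_baseChange_basis b s]
  simp [hcoeff]

end FieldExtension

variable {L : Type u} [Field L] {P : Type v} [AddCommGroup P] [Module (Env L) P]

theorem FieldTensor.of_symm_smul (K : Subfield L) (a b : L) (t : FieldTensor K) :
    (FieldTensor.of L K).symm ((a ⊗ₜ[ℤ] op b : Env L) • t) =
      (a ⊗ₜ[K] b) * (FieldTensor.of L K).symm t := by
  change envToFieldTensor L K (a ⊗ₜ[ℤ] op b) * _ = _
  simp [envToFieldTensor]
  rfl

theorem FieldTensor.finite (K : Subfield L) [FiniteDimensional K L] :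
    letI := leftModule L (FieldTensor K)
    Module.Finite L (FieldTensor K) := by
  let _ := leftModule L (FieldTensor K)
  let e : FieldTensor K ≃ₗ[L] L ⊗[K] L :=
    { (FieldTensor.of L K).symm with
      map_smul' := fun a t => by
        refine (FieldTensor.of_symm_smul K a 1 t).trans ?_
        change _ = a • (FieldTensor.of L K).symm t
        rw [Algebra.smul_def, Algebra.TensorProduct.algebraMap_apply]
        rfl }
  exact Module.Finite.equiv e.symm

/-- The bimodule homomorphism `L ⊗_K L → P`, `x ⊗ y ↦ x p y`, for the center `K` of `P`. -/
theorem exists_orbit_map (p : P) : ∃ F : FieldTensor (center L P) →ₗ[Env L] P,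
    ∀ x y, F (FieldTensor.of L _ (x ⊗ₜ y)) = (x ⊗ₜ[ℤ] op y : Env L) • p := by
  let B : L →+ L →+ P := AddMonoidHom.mk' (fun x => AddMonoidHom.mk'
      (fun y => (x ⊗ₜ[ℤ] op y : Env L) • p) fun y z => by
        rw [op_add, TensorProduct.tmul_add, add_smul]) fun x z => by
    ext y
    change ((x + z) ⊗ₜ[ℤ] op y : Env L) • p = _
    rw [TensorProduct.add_tmul, add_smul]
    rfl
  let F₀ : L ⊗[center L P] L →+ P := TensorProduct.liftAddHom B fun z x y => by
    change ((z • x) ⊗ₜ[ℤ] op y : Env L) • p = (x ⊗ₜ[ℤ] op (z • y) : Env L) • p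
    rw [Algebra.smul_def, Algebra.smul_def]
    refine Eq.trans ?_ (center_tmul_op_smul z.2 x y p).symm
    rw [mul_comm x]
    rfl
  have hF₀ : ∀ x y, F₀ (x ⊗ₜ y) = (x ⊗ₜ[ℤ] op y : Env L) • p := fun x y =>
    TensorProduct.liftAddHom_tmul _ _ _ _
  let F : FieldTensor (center L P) →+ P := F₀.comp (FieldTensor.of L _).symm.toAddMonoidHom
  have hF : ∀ x y, F (FieldTensor.of L _ (x ⊗ₜ y)) = (x ⊗ₜ[ℤ] op y : Env L) • p := hF₀
  refine ⟨{ F with map_smul' := fun r t => ?_ }, hF⟩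
  change F (r • t) = r • F t
  induction r using TensorProduct.induction_on with
  | zero => simp
  | add r s hr hs => rw [add_smul, map_add, hr, hs, add_smul]
  | tmul a b =>
    obtain ⟨b, rfl⟩ := op_surjective b
    obtain ⟨t, rfl⟩ := (FieldTensor.of L _).surjective t
    induction t using TensorProduct.induction_on with
    | zero => simp
    | add t s ht hs => rw [map_add, smul_add, map_add, ht, hs, map_add, smul_add]
    | tmul x y =>
      rw [FieldTensor.smul_of, hF, hF, ← mul_smul, tmul_op_mul, mul_comm y]

/-- The ring `L ⊗_K L` acts faithfully on `P`, for the center `K` of `P`. -/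
theorem IsWeaklyGalois.eq_zero_of_orbit_map {d : ℕ} (hP : IsWeaklyGalois L P d)
    (F : P → FieldTensor (center L P) →ₗ[Env L] P)
    (hF : ∀ p x y, F p (FieldTensor.of L _ (x ⊗ₜ y)) = (x ⊗ₜ[ℤ] op y : Env L) • p)
    {t : FieldTensor (center L P)} (ht : ∀ p, F p t = 0) : t = 0 := by
  have := hP.finiteDimensional_center
  let b := Module.finBasis (center L P) L
  obtain ⟨t, rfl⟩ := (FieldTensor.of L _).surjective t
  rw [eq_sum_baseChange_basis b t] at ht ⊢
  have := hP.coeff_eq_zero b.linearIndependent Finset.univ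
    (fun i => (b.baseChange L).repr t i) fun p => by
      rw [← ht p, map_sum, map_sum]
      simp only [hF]
  simp [this]

theorem IsPurelyInseparableWeaklyGalois.exists_injective_fieldTensor {d : ℕ}
    (h : IsPurelyInseparableWeaklyGalois L P d) :
    ∃ f : FieldTensor (center L P) →ₗ[Env L] P, Function.Injective f := by
  have hW := h.weaklyGalois
  have := hW.finiteDimensional_center
  have := isArtinian_env (FieldTensor.finite (center L P))
  choose F hF using fun p : P => exists_orbit_map (L := L) p
  by_contra! hnot
  have hatom : ∀ S : Submodule (Env L) (FieldTensor (center L P)), IsAtom S →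
      ∀ s ∈ S, ∀ a : L, commutator a • s = 0 := by
    intro S hS s hs a
    obtain ⟨n, hn⟩ := h.exists_commutator_pow a
    refine smul_eq_zero_of_isAtom hS (n := n) (fun x _ => ?_) s hs
    -- Nilpotence on `P` passes to `L ⊗_K L` by faithfulness: every orbit map kills `commutator a ^
    -- n • x`.
    exact hW.eq_zero_of_orbit_map F hF fun p => by rw [map_smul, hn]
  obtain ⟨τ, hτ⟩ := exists_functional_tensor (K := center L P) (L := L)
  have hnt : Nontrivial (FieldTensor (center L P)) :=
    (FieldTensor.of L (center L P)).symm.toEquiv.nontrivial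
  obtain ⟨S₀, hS₀, -⟩ := (eq_bot_or_exists_atom_le
    (⊤ : Submodule (Env L) (FieldTensor (center L P)))).resolve_left top_ne_bot
  obtain ⟨s₀, hs₀, hne⟩ := S₀.exists_mem_ne_zero_of_ne_bot hS₀.1
  -- It remains to see that `s₀` lies in the kernel of every orbit map. Each kernel is nonzero and
  -- contains a simple sub-bimodule `S`, whose nonzero elements are left multiples of `s₀` and
  -- conversely.
  refine hne (hW.eq_zero_of_orbit_map F hF fun p => ?_)
  obtain ⟨S, hS, hle⟩ := (eq_bot_or_exists_atom_le (LinearMap.ker (F p))).resolve_left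
    fun hb => hnot (F p) (LinearMap.ker_eq_bot.1 hb)
  obtain ⟨s, hs, hs1⟩ := S.exists_mem_ne_zero_of_ne_bot hS.1
  let o := (FieldTensor.of L (center L P)).symm
  have hagree : ∀ t, (∀ a : L, commutator a • t = 0) →
      ∀ a : L, a ⊗ₜ[center L P] (1 : L) * o t = (1 : L) ⊗ₜ a * o t := by
    intro t ht a
    have := congrArg o (ht a)
    rw [commutator, sub_smul, map_sub, map_zero, sub_eq_zero] at this
    rwa [FieldTensor.of_symm_smul, FieldTensor.of_symm_smul] at this
  have hsa := hagree s (hatom S hS s hs)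
  have hsa₀ := hagree s₀ (hatom S₀ hS₀ s₀ hs₀)
  have hτs : τ (o s) ≠ 0 := fun h0 => hs1 (o.map_eq_zero_iff.1 (hτ _ hsa h0))
  -- The scalar is chosen so that `τ` vanishes on the difference, on which both actions still agree.
  have hprop : o s₀ = (τ (o s₀) * (τ (o s))⁻¹) • o s := by
    rw [← sub_eq_zero]
    refine hτ _ (fun a => ?_) ?_
    · rw [mul_sub, mul_sub, hsa₀, mul_smul_comm, mul_smul_comm, hsa]
    · rw [map_sub, map_smul, smul_eq_mul, inv_mul_cancel_right₀ hτs, sub_self]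
  have hmem : s₀ = ((τ (o s₀) * (τ (o s))⁻¹) ⊗ₜ[ℤ] op 1 : Env L) • s := by
    refine o.injective (hprop.trans ?_)
    rw [FieldTensor.of_symm_smul, Algebra.smul_def, Algebra.TensorProduct.algebraMap_apply]
    rfl
  rw [hmem, map_smul, LinearMap.mem_ker.1 (hle hs), smul_zero]

end Embedding

end GaloisBimodule

theorem mainTheorem11 {L : Type*} [Field L] {P : Type*} [AddCommGroup P]
    [Module (GaloisBimodule.Env L) P] (d : ℕ)
    (hP : GaloisBimodule.IsPurelyInseparableWeaklyGalois L P d) :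
    FiniteDimensional (GaloisBimodule.center L P) L ∧
    IsPurelyInseparable (GaloisBimodule.center L P) L ∧
    ∃ f : GaloisBimodule.FieldTensor (GaloisBimodule.center L P) →ₗ[GaloisBimodule.Env L] P,
      Function.Injective f :=
  ⟨hP.weaklyGalois.finiteDimensional_center, hP.isPurelyInseparable_center,
    hP.exists_injective_fieldTensor⟩
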